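/- Let $(R,\mathfrak m)$ be a Noetherian local ring of dimension $d\ge 1$. For an $\mathfrak m$-primary ideal $I$ let $\mu(I)$ be its minimal number of generators, let $\ell\ell(I)$ be the smallest integer $n$ with $\mathfrak m^n\subseteq I$, and let $e(I)=\lim_{k\to\infty} d!\,\ell(R/I^k)/k^d$ be its Hilbert–Samuel multiplicity, where $\ell$ denotes length; put $e(R)=e(\mathfrak m)$. Suppose that $R$ is Cohen–Macaulay and has minimal multiplicity, i.e. $e(R)=\mu(\mathfrak m)-d+1$. Then for every integer $n\ge 1$ the ideal $I=\mathfrak m^n$ satisfies $$(d-1)!\,\bigl(\mu(I)-d+1\bigr)\,\ell\ell(I)\ \ge\ e(I).$$ -/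

import Mathlib

open Filter Topology IsLocalRing

noncomputable section

namespace PowersInequality

/-- The Krull dimension of a ring, as a natural number. It agrees with `ringKrullDim` whenever the
latter is a natural number, in particular for every Noetherian local ring. -/
def dim (R : Type*) [CommRing R] : ℕ :=
  ((ringKrullDim R).unbotD 0).toNat

/-- A Noetherian local ring is Cohen–Macaulay if its maximal ideal contains an `R`-regular sequence
of length `dim R` (that is, if its depth equals its dimension). -/
def IsCohenMacaulay (R : Type*) [CommRing R] [IsLocalRing R] : Prop :=
  ∃ rs : List R, (∀ r ∈ rs, r ∈ maximalIdeal R) ∧ RingTheory.Sequence.IsRegular R rs ∧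
    (rs.length : WithBot ℕ∞) = ringKrullDim R

section Ideals

variable {R : Type*} [CommRing R]

/-- The number `e` is the Hilbert–Samuel multiplicity of the `𝔪`-primary ideal `I`:
`e = lim_k d! · ℓ(R / I ^ k) / k ^ d`, where `d = dim R`. -/
def HasMultiplicity (I : Ideal R) (e : ℝ) : Prop :=
  Tendsto
    (fun k : ℕ => ((dim R).factorial : ℝ) * ((Module.length R (R ⧸ I ^ k)).toNat : ℝ)
      / (k : ℝ) ^ dim R)
    atTop (𝓝 e)

/-- The minimal number of generators of an ideal (finitely generated, in a Noetherian ring). -/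
def numGenerators (I : Ideal R) : ℕ :=
  Submodule.spanFinrank I

/-- The Loewy length of `R / I`: the smallest `n` with `𝔪 ^ n ⊆ I`, for an `𝔪`-primary ideal `I`. -/
def loewyLength [IsLocalRing R] (I : Ideal R) : ℕ :=
  sInf {n : ℕ | maximalIdeal R ^ n ≤ I}

/-- The inequality `(d - 1)! (μ(I) - d + 1) ℓℓ(I) ≥ e(I)` for an `𝔪`-primary ideal `I` of a
Noetherian local ring of dimension `d ≥ 1`; that the limit defining `e(I)` exists is part of it. -/
def SatisfiesInequalityA [IsLocalRing R] (I : Ideal R) : Prop :=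
  ∃ e : ℝ, HasMultiplicity I e ∧
    ((dim R - 1).factorial : ℝ) * ((numGenerators I : ℝ) - (dim R : ℝ) + 1) * (loewyLength I : ℝ)
      ≥ e

end Ideals

/-- `R` has minimal multiplicity: `e(R) = μ(𝔪) - dim R + 1`, where `e(R) = e(𝔪)`. -/
def HasMinimalMultiplicity (R : Type*) [CommRing R] [IsLocalRing R] : Prop :=
  HasMultiplicity (maximalIdeal R) ((numGenerators (maximalIdeal R) : ℝ) - (dim R : ℝ) + 1)

end PowersInequality

end

namespace PowersInequality

open RingTheory.Sequence Pointwise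

/-! ### Cancelling a regular element from powers of an ideal -/

section RegularSequences

universe u

variable {R : Type u} [CommRing R]

/-! Minimal multiplicity forces the whole Hilbert function of `R`; what remains is an estimate of
binomial coefficients. Write `d` for the dimension and `e = e(R)`.

Localising `R[X]` at `𝔪R[X]` changes no length `ℓ(R/𝔪^k)` and makes the residue field infinite.
Superficial elements then give a regular sequence of length `d` whose ideal `J` satisfies `𝔪^(N+n) ⊆
J^n` for a fixed `N` (`exists_reduction`). As `ℓ(R/J^(n+1)) = C(n+d,d) ℓ(R/J)`, squeezing gives `e =
ℓ(R/J)`. Next, `ℓ(R/J𝔪) = ℓ(R/J) + d = e + d` (`length_quotient_ofList_pow_mul_maximalIdeal`), while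
minimal multiplicity says `ℓ(R/𝔪²) = 1 + μ(𝔪) = e + d`. Since `J𝔪 ⊆ 𝔪²`, the two ideals agree, so
`𝔪^(n+1) = J^n 𝔪` for all `n ≥ 1`, of known colength.

Differences of colengths give `μ(𝔪^n) = C(n+d-1,d-1) + (e-1) C(n+d-2,d-1)`. Multiplied by `(d-1)!`,
the binomials become rising factorials, each at least `n^(d-1)`, and the first exceeds this by
enough to absorb `(d-1)!(d-1)`. Hence `(d-1)!(μ(𝔪^n)-d+1) ≥ n^(d-1) e`. Multiply by `ℓℓ(𝔪^n) ≥ n`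
and use `e(𝔪^n) = n^d e`. -/

theorem isWeaklyRegular_cons_iff_quotient (x : R) (rs : List R) :
    IsWeaklyRegular R (x :: rs) ↔ IsSMulRegular R x ∧
      IsWeaklyRegular (R ⧸ Ideal.span {x}) (rs.map (Ideal.Quotient.mk (Ideal.span {x}))) := by
  have h : x • (⊤ : Submodule R R) = Ideal.span {x} := by
    simp [← Submodule.ideal_span_singleton_smul]
  rw [isWeaklyRegular_cons_iff]
  refine and_congr_right' ?_
  rw [(Submodule.quotEquivOfEq _ _ h).isWeaklyRegular_congr]
  exact (isWeaklyRegular_map_algebraMap_iff (R ⧸ Ideal.span {x}) _ rs).symm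

theorem isSMulRegular_quotient_ideal_iff (I : Ideal R) (z : R) :
    IsSMulRegular (R ⧸ I) z ↔ ∀ a, z * a ∈ I → a ∈ I := by
  rw [isSMulRegular_iff_right_eq_zero_of_smul]
  constructor
  · intro h a ha
    rw [← Ideal.Quotient.eq_zero_iff_mem] at ha ⊢
    exact h _ ha
  · intro h a
    obtain ⟨a, rfl⟩ := Ideal.Quotient.mk_surjective a
    intro ha
    rw [Ideal.Quotient.eq_zero_iff_mem]
    exact h a (Ideal.Quotient.eq_zero_iff_mem.mp ha)

theorem isWeaklyRegular_concat_iff (rs : List R) (z : R) :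
    IsWeaklyRegular R (rs ++ [z]) ↔ IsWeaklyRegular R rs ∧
      IsSMulRegular (R ⧸ Ideal.ofList rs) z := by
  rw [isWeaklyRegular_append_iff, isWeaklyRegular_singleton_iff]
  refine and_congr_right' ?_
  have h : Ideal.ofList rs • (⊤ : Submodule R R) = Ideal.ofList rs := by simp
  exact (Submodule.quotEquivOfEq _ _ h).isSMulRegular_congr z

theorem sup_pow_succ_le (I J : Ideal R) (n : ℕ) :
    (I ⊔ J) ^ (n + 1) ≤ I * (I ⊔ J) ^ n ⊔ J ^ (n + 1) := by
  induction n with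
  | zero => simp
  | succ n ih =>
    calc (I ⊔ J) ^ (n + 1 + 1) = I * (I ⊔ J) ^ (n + 1) ⊔ J * (I ⊔ J) ^ (n + 1) := by
          rw [pow_succ' (I ⊔ J) (n + 1), Ideal.sup_mul]
      _ ≤ I * (I ⊔ J) ^ (n + 1) ⊔ J * (I * (I ⊔ J) ^ n ⊔ J ^ (n + 1)) :=
          sup_le_sup_left (Ideal.mul_mono_right ih) _
      _ ≤ _ := by
          rw [Ideal.mul_sup, ← pow_succ', ← mul_assoc, mul_comm J I, mul_assoc]
          refine sup_le le_sup_left (sup_le (le_sup_of_le_left (Ideal.mul_mono_right ?_))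
            le_sup_right)
          rw [pow_succ' (I ⊔ J) n]
          exact Ideal.mul_mono_left le_sup_right

/-- With `J = (x, rs)`, one has `J^(n+1) K ⊆ x J^n K + (rs)^(n+1)`. If `xa = xb + c` accordingly,
cancelling `x` modulo `(rs)^(n+1)` puts `a - b` in `(rs)^(n+1)`, hence in `J^n K`. The factor `K` is
later the unit ideal or `𝔪`. -/
theorem mem_pow_of_mul_mem_pow_cons {x : R} {rs : List R}
    (hx : ∀ n a, x * a ∈ Ideal.ofList rs ^ n → a ∈ Ideal.ofList rs ^ n)
    {K : Ideal R} (hK : Ideal.ofList (x :: rs) ≤ K) (n : ℕ) {a : R}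
    (ha : x * a ∈ Ideal.ofList (x :: rs) ^ (n + 1) * K) :
    a ∈ Ideal.ofList (x :: rs) ^ n * K := by
  set J := Ideal.ofList (x :: rs) with hJ
  have hJ' : J = Ideal.span {x} ⊔ Ideal.ofList rs := by rw [hJ, Ideal.ofList_cons]
  have h1 : J ^ (n + 1) * K ≤ Ideal.span {x} * (J ^ n * K) ⊔ Ideal.ofList rs ^ (n + 1) := by
    have := sup_pow_succ_le (Ideal.span {x}) (Ideal.ofList rs) n
    rw [← hJ'] at this
    refine (Ideal.mul_mono_left this).trans ?_
    rw [Ideal.sup_mul, mul_assoc]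
    exact sup_le_sup_left Ideal.mul_le_left _
  obtain ⟨y, hy, c, hc, hyc⟩ := Submodule.mem_sup.mp (h1 ha)
  obtain ⟨b, hb, rfl⟩ := Ideal.mem_span_singleton_mul.mp hy
  have hab : a - b ∈ Ideal.ofList rs ^ (n + 1) := by
    apply hx
    have : x * (a - b) = c := by rw [mul_sub, ← hyc]; ring
    rwa [this]
  have h2 : Ideal.ofList rs ^ (n + 1) ≤ J ^ n * K := by
    rw [pow_succ]
    have : Ideal.ofList rs ≤ J := hJ' ▸ le_sup_right
    exact Ideal.mul_mono (Ideal.pow_right_mono this n) (this.trans hK)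
  simpa using add_mem hb (h2 hab)

theorem map_mk_ofList_cons (x : R) (rs : List R) :
    (Ideal.ofList (x :: rs)).map (Ideal.Quotient.mk (Ideal.span {x})) =
      Ideal.ofList (rs.map (Ideal.Quotient.mk (Ideal.span {x}))) := by
  rw [Ideal.ofList_cons, Ideal.map_sup, Ideal.map_quotient_self, bot_sup_eq, Ideal.map_ofList]

end RegularSequences

/-! ### Regular sequences in Noetherian local rings -/

section Local

universe u

variable {R : Type u} [CommRing R] [IsLocalRing R]

theorem isLocalRing_quotient_span_singleton {x : R} (hx : x ∈ maximalIdeal R) :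
    IsLocalRing (R ⧸ Ideal.span {x}) := by
  have : Nontrivial (R ⧸ Ideal.span {x}) := by
    rw [Ideal.Quotient.nontrivial_iff]
    intro h
    have h1 : Ideal.span {x} ≤ maximalIdeal R := by simpa using hx
    exact (maximalIdeal.isMaximal R).ne_top (top_le_iff.mp (h ▸ h1))
  exact IsLocalRing.of_surjective' _ Ideal.Quotient.mk_surjective

theorem map_mk_maximalIdeal (I : Ideal R) [IsLocalRing (R ⧸ I)] :
    (maximalIdeal R).map (Ideal.Quotient.mk I) = maximalIdeal (R ⧸ I) := by
  have := IsLocalHom.of_surjective (Ideal.Quotient.mk I) Ideal.Quotient.mk_surjective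
  exact IsLocalRing.map_maximalIdeal_of_surjective _ Ideal.Quotient.mk_surjective

theorem mk_mem_maximalIdeal {I : Ideal R} [IsLocalRing (R ⧸ I)] {rs : List R}
    (h : ∀ r ∈ rs, r ∈ maximalIdeal R) :
    ∀ r ∈ rs.map (Ideal.Quotient.mk I), r ∈ maximalIdeal (R ⧸ I) := by
  intro r hr
  obtain ⟨s, hs, rfl⟩ := List.mem_map.mp hr
  rw [← map_mk_maximalIdeal I]
  exact Ideal.mem_map_of_mem _ (h s hs)

variable [IsNoetherianRing R]

/-- Regular sequences in the maximal ideal of a Noetherian local ring may be permuted, so the head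
can be moved last. -/
theorem isSMulRegular_head_quotient_tail {x : R} {rs : List R} (h : IsWeaklyRegular R (x :: rs))
    (hm : ∀ r ∈ x :: rs, r ∈ maximalIdeal R) :
    IsWeaklyRegular R rs ∧ IsSMulRegular (R ⧸ Ideal.ofList rs) x := by
  rw [← isWeaklyRegular_concat_iff]
  exact isWeaklyRegular_of_perm_of_subset_maximalIdeal h (List.perm_append_singleton x rs).symm hm

/-- An element regular modulo an ideal generated by a regular sequence is regular modulo the powers
of this ideal. -/
theorem mem_pow_of_mul_mem_pow (k : ℕ) : ∀ {R : Type u} [CommRing R] [IsLocalRing R]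
    [IsNoetherianRing R] {rs : List R}, rs.length = k → IsWeaklyRegular R rs →
    (∀ r ∈ rs, r ∈ maximalIdeal R) → ∀ {z : R}, IsSMulRegular (R ⧸ Ideal.ofList rs) z →
    ∀ n a, z * a ∈ Ideal.ofList rs ^ n → a ∈ Ideal.ofList rs ^ n := by
  induction k with
  | zero =>
    intro R _ _ _ rs hk _ _ z hz n a ha
    obtain rfl := List.length_eq_zero_iff.mp hk
    rw [isSMulRegular_quotient_ideal_iff] at hz
    rcases n with _ | n
    · simp
    · simp only [Ideal.ofList_nil, ne_eq, Nat.add_eq_zero_iff, one_ne_zero, and_false,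
        not_false_eq_true, ← Ideal.zero_eq_bot, zero_pow] at hz ha ⊢
      exact hz a ha
  | succ k ih =>
    intro R _ _ _ rs hk hrs hm z hz
    obtain ⟨x, rs, rfl⟩ := List.exists_cons_of_length_eq_add_one hk
    have hk' : rs.length = k := by simpa using hk
    obtain ⟨h1, h2⟩ := isSMulRegular_head_quotient_tail hrs hm
    have hx := ih hk' h1 (fun r hr => hm r (List.mem_cons_of_mem _ hr)) h2
    have hxm := hm x List.mem_cons_self
    have := isLocalRing_quotient_span_singleton hxm
    obtain ⟨hx0, hrs'⟩ := (isWeaklyRegular_cons_iff_quotient x rs).mp hrs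
    have key := ih (R := R ⧸ Ideal.span {x}) (rs := rs.map (Ideal.Quotient.mk (Ideal.span {x})))
      (by simpa using hk') hrs'
      (mk_mem_maximalIdeal fun r hr => hm r (List.mem_cons_of_mem _ hr))
      (z := Ideal.Quotient.mk _ z) (by
        rw [isSMulRegular_quotient_ideal_iff] at hz ⊢
        intro a
        obtain ⟨a, rfl⟩ := Ideal.Quotient.mk_surjective a
        have hsup : Ideal.ofList (x :: rs) ⊔ Ideal.span {x} = Ideal.ofList (x :: rs) := by
          rw [Ideal.ofList_cons]; simp
        rw [← map_mk_ofList_cons, ← map_mul, Ideal.mem_quotient_iff_mem_sup,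
          Ideal.mem_quotient_iff_mem_sup, hsup]
        exact hz a)
    intro n
    induction n with
    | zero => simp
    | succ n ihn =>
      intro a ha
      have h3 := key (n + 1) (Ideal.Quotient.mk _ a) (by
        rw [← map_mk_ofList_cons, ← Ideal.map_pow, ← map_mul]
        exact Ideal.mem_map_of_mem _ ha)
      rw [← Ideal.map_ofList, ← Ideal.map_pow, Ideal.mem_quotient_iff_mem_sup] at h3
      obtain ⟨b, hb, y, hy, rfl⟩ := Submodule.mem_sup.mp h3
      obtain ⟨c, rfl⟩ := Ideal.mem_span_singleton'.mp hy
      have hle : Ideal.ofList rs ≤ Ideal.ofList (x :: rs) := by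
        rw [Ideal.ofList_cons]; exact le_sup_right
      have hb' := Ideal.pow_right_mono hle (n + 1) hb
      refine add_mem hb' ?_
      -- After subtracting `b`, only `xzc` remains: `x` cancels by the induction on the length of
      -- the sequence, then `z` by the induction on `n`.
      have h4 : x * (z * c) ∈ Ideal.ofList (x :: rs) ^ (n + 1) := by
        have := sub_mem ha (Ideal.mul_mem_left _ z hb')
        convert this using 1
        ring
      have h5 := mem_pow_of_mul_mem_pow_cons hx le_top n (a := z * c) (by simpa using h4)
      have h6 := ihn c (by simpa using h5)
      have hxJ : x ∈ Ideal.ofList (x :: rs) := by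
        rw [Ideal.ofList_cons]
        exact Ideal.mem_sup_left (Ideal.mem_span_singleton_self x)
      rw [pow_succ', mul_comm c]
      exact Ideal.mul_mem_mul hxJ h6

theorem mem_of_mul_mem_ofList_pow_mul {x : R} {rs : List R} (h : IsWeaklyRegular R (x :: rs))
    (hm : ∀ r ∈ x :: rs, r ∈ maximalIdeal R) {K : Ideal R} (hK : Ideal.ofList (x :: rs) ≤ K)
    (n : ℕ) {a : R} (ha : x * a ∈ Ideal.ofList (x :: rs) ^ (n + 1) * K) :
    a ∈ Ideal.ofList (x :: rs) ^ n * K := by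
  obtain ⟨h1, h2⟩ := isSMulRegular_head_quotient_tail h hm
  exact mem_pow_of_mul_mem_pow_cons (mem_pow_of_mul_mem_pow _ rfl h1
    (fun r hr => hm r (List.mem_cons_of_mem _ hr)) h2) hK n ha

end Local

/-! ### Lengths of quotients by ideals -/

section Length

universe u

variable {R : Type u} [CommRing R]

theorem length_quotient_sup_span_singleton (I : Ideal R) (x : R) :
    Module.length (R ⧸ Ideal.span {x})
      ((R ⧸ Ideal.span {x}) ⧸ I.map (Ideal.Quotient.mk (Ideal.span {x}))) =
      Module.length R (R ⧸ I ⊔ Ideal.span {x}) := by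
  rw [← Module.length_eq_of_surjective (S := R) (R := R ⧸ Ideal.span {x})
    Ideal.Quotient.mk_surjective, sup_comm]
  exact (DoubleQuot.quotQuotEquivQuotSupₐ R (Ideal.span {x}) I).toLinearEquiv.length_eq

/-- The hypothesis says `K = (I : x)`, so multiplication by `x` gives the exact sequence `0 → R/K →
R/I → R/(I + (x)) → 0`. -/
theorem length_quotient_eq_add {I K : Ideal R} {x : R} (h : ∀ a, x * a ∈ I ↔ a ∈ K) :
    Module.length R (R ⧸ I) = Module.length R (R ⧸ K) +
      Module.length (R ⧸ Ideal.span {x})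
        ((R ⧸ Ideal.span {x}) ⧸ I.map (Ideal.Quotient.mk (Ideal.span {x}))) := by
  rw [length_quotient_sup_span_singleton]
  have hK : K ≤ Submodule.comap (LinearMap.mulLeft R x) I := fun a ha => (h a).mpr ha
  refine Module.length_eq_add_of_exact (Submodule.mapQ K I (LinearMap.mulLeft R x) hK)
    (Submodule.factor (le_sup_left : I ≤ I ⊔ Ideal.span {x})) ?_ ?_ ?_
  · rw [injective_iff_map_eq_zero]
    intro a
    obtain ⟨a, rfl⟩ := Submodule.mkQ_surjective _ a
    intro ha
    simp only [Submodule.mkQ_apply, Submodule.mapQ_apply, Submodule.Quotient.mk_eq_zero] at ha ⊢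
    exact (h a).mp ha
  · exact Submodule.factor_surjective _
  · intro a
    obtain ⟨a, rfl⟩ := Submodule.mkQ_surjective _ a
    constructor
    · intro ha
      obtain ⟨b, hb, y, hy, rfl⟩ := Submodule.mem_sup.mp ((Submodule.Quotient.mk_eq_zero _).mp ha)
      obtain ⟨c, rfl⟩ := Ideal.mem_span_singleton.mp hy
      refine ⟨Submodule.Quotient.mk c, ?_⟩
      simp only [Submodule.mapQ_apply, Submodule.mkQ_apply, LinearMap.mulLeft_apply]
      rw [Submodule.Quotient.eq]
      simpa using hb
    · rintro ⟨b, hb⟩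
      obtain ⟨b, rfl⟩ := Submodule.mkQ_surjective _ b
      rw [← hb]
      refine (Submodule.Quotient.mk_eq_zero _).mpr ?_
      exact Ideal.mem_sup_right (Ideal.mul_mem_right _ _ (Ideal.mem_span_singleton_self x))

variable [IsLocalRing R]

theorem length_quotient_maximalIdeal : Module.length R (R ⧸ maximalIdeal R) = 1 := by
  rw [Module.length_eq_one_iff]
  exact isSimpleModule_iff_quot_maximal.mpr ⟨maximalIdeal R, inferInstance, ⟨LinearEquiv.refl _ _⟩⟩

variable [IsNoetherianRing R]

theorem isArtinianRing_quotient {I : Ideal R} {n : ℕ} (h : maximalIdeal R ^ n ≤ I) :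
    IsArtinianRing (R ⧸ I) := by
  by_cases hI : I = ⊤
  · have : Subsingleton (R ⧸ I) := Ideal.Quotient.subsingleton_iff.mpr hI
    infer_instance
  have : Nontrivial (R ⧸ I) := Ideal.Quotient.nontrivial_iff.mpr hI
  have := IsLocalRing.of_surjective' (Ideal.Quotient.mk I) Ideal.Quotient.mk_surjective
  rw [isArtinianRing_iff_isNilpotent_maximalIdeal]
  refine ⟨n, ?_⟩
  rw [← map_mk_maximalIdeal I, ← Ideal.map_pow, Ideal.zero_eq_bot, Ideal.map_eq_bot_iff_le_ker,
    Ideal.mk_ker]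
  exact h

theorem isFiniteLength_quotient {I : Ideal R} {n : ℕ} (h : maximalIdeal R ^ n ≤ I) :
    IsFiniteLength R (R ⧸ I) := by
  have hA := isArtinianRing_quotient h
  rw [← Module.length_ne_top_iff, Module.length_eq_of_surjective (R := R ⧸ I)
    Ideal.Quotient.mk_surjective, Module.length_ne_top_iff]
  exact (IsArtinianRing.tfae (R ⧸ I) (R ⧸ I)).out 2 3 |>.mp hA

theorem length_quotient_ne_top {I : Ideal R} {n : ℕ} (h : maximalIdeal R ^ n ≤ I) :
    Module.length R (R ⧸ I) ≠ ⊤ :=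
  Module.length_ne_top_iff.mpr (isFiniteLength_quotient h)

end Length

/-! ### Colengths of `J^n` and `J^n 𝔪` for `J` generated by a regular sequence -/

section RegularSequenceLengths

universe u

theorem length_quotient_le {R : Type u} [CommRing R] {I K : Ideal R} (h : I ≤ K) :
    Module.length R (R ⧸ K) ≤ Module.length R (R ⧸ I) :=
  Module.length_le_of_surjective (Submodule.factor h) (Submodule.factor_surjective h)

theorem eq_of_length_quotient_eq {R : Type u} [CommRing R] {I K : Ideal R} (h : I ≤ K)
    (hI : Module.length R (R ⧸ I) ≠ ⊤)
    (hl : Module.length R (R ⧸ I) = Module.length R (R ⧸ K)) : I = K := by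
  have hf := Module.length_ne_top_iff.mp hI
  rw [isFiniteLength_iff_isNoetherian_isArtinian] at hf
  obtain ⟨_, _⟩ := hf
  by_contra hne
  have h2 : (Submodule.map I.mkQ K) ≠ ⊥ := by
    intro h0
    have h5 := LinearMap.le_ker_iff_map.mpr h0
    rw [Submodule.ker_mkQ] at h5
    exact hne (le_antisymm h h5)
  have h3 := Submodule.length_quotient_lt _ h2
  have h4 := (Submodule.quotientQuotientEquivQuotient I K h).length_eq
  rw [h4, hl] at h3
  exact lt_irrefl _ h3

theorem length_quotient_ofList_pow_mul {R : Type u} [CommRing R] [IsLocalRing R]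
    [IsNoetherianRing R] {x : R} {rs : List R} (h : IsWeaklyRegular R (x :: rs))
    (hm : ∀ r ∈ x :: rs, r ∈ maximalIdeal R) {K : Ideal R} (hK : Ideal.ofList (x :: rs) ≤ K)
    (n : ℕ) :
    Module.length R (R ⧸ Ideal.ofList (x :: rs) ^ (n + 1) * K) =
      Module.length R (R ⧸ Ideal.ofList (x :: rs) ^ n * K) +
      Module.length (R ⧸ Ideal.span {x}) ((R ⧸ Ideal.span {x}) ⧸
        Ideal.ofList (rs.map (Ideal.Quotient.mk (Ideal.span {x}))) ^ (n + 1) *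
          K.map (Ideal.Quotient.mk (Ideal.span {x}))) := by
  rw [← map_mk_ofList_cons, ← Ideal.map_pow, ← Ideal.map_mul]
  refine length_quotient_eq_add fun a => ⟨mem_of_mul_mem_ofList_pow_mul h hm hK n, fun ha => ?_⟩
  rw [pow_succ', mul_assoc]
  refine Ideal.mul_mem_mul ?_ ha
  rw [Ideal.ofList_cons]
  exact Ideal.mem_sup_left (Ideal.mem_span_singleton_self x)

theorem length_quotient_map_ofList {R : Type u} [CommRing R] (x : R) (rs : List R) :
    Module.length (R ⧸ Ideal.span {x}) ((R ⧸ Ideal.span {x}) ⧸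
      Ideal.ofList (rs.map (Ideal.Quotient.mk (Ideal.span {x})))) =
      Module.length R (R ⧸ Ideal.ofList (x :: rs)) := by
  rw [← map_mk_ofList_cons, length_quotient_sup_span_singleton]
  have : Ideal.ofList (x :: rs) ⊔ Ideal.span {x} = Ideal.ofList (x :: rs) := by
    rw [Ideal.ofList_cons]; simp
  rw [this]

/-- Double induction on `d` and `n`: the exact sequence of multiplication by `x` turns into Pascal's
rule. -/
theorem length_quotient_ofList_pow (d : ℕ) : ∀ {R : Type u} [CommRing R] [IsLocalRing R]
    [IsNoetherianRing R] {rs : List R}, rs.length = d → IsWeaklyRegular R rs →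
    (∀ r ∈ rs, r ∈ maximalIdeal R) → ∀ n : ℕ,
    Module.length R (R ⧸ Ideal.ofList rs ^ (n + 1)) =
      (n + d).choose d * Module.length R (R ⧸ Ideal.ofList rs) := by
  induction d with
  | zero =>
    intro R _ _ _ rs hk _ _ n
    obtain rfl := List.length_eq_zero_iff.mp hk
    have h : (Ideal.ofList ([] : List R)) ^ (n + 1) = Ideal.ofList [] := by
      rw [Ideal.ofList_nil, ← Ideal.zero_eq_bot, zero_pow (Nat.succ_ne_zero n)]
    rw [h]
    simp
  | succ d ih =>
    intro R _ _ _ rs hk hrs hm n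
    obtain ⟨x, rs, rfl⟩ := List.exists_cons_of_length_eq_add_one hk
    have hk' : rs.length = d := by simpa using hk
    have := isLocalRing_quotient_span_singleton (hm x List.mem_cons_self)
    obtain ⟨-, hrs'⟩ := (isWeaklyRegular_cons_iff_quotient x rs).mp hrs
    have key := ih (R := R ⧸ Ideal.span {x}) (rs := rs.map (Ideal.Quotient.mk (Ideal.span {x})))
      (by simpa using hk') hrs'
      (mk_mem_maximalIdeal fun r hr => hm r (List.mem_cons_of_mem _ hr))
    induction n with
    | zero => rw [zero_add, pow_one]; simp
    | succ n ihn =>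
      have h := length_quotient_ofList_pow_mul hrs hm le_top (n + 1)
      rw [Ideal.map_top, Ideal.mul_top, Ideal.mul_top, Ideal.mul_top, key, ihn,
        length_quotient_map_ofList] at h
      rw [h, ← add_mul, ← Nat.cast_add]
      congr 2
      rw [show n + 1 + (d + 1) = (n + 1 + d) + 1 by ring, Nat.choose_succ_succ, add_comm,
        show n + (d + 1) = n + 1 + d by ring]

/-- The same induction with `K = 𝔪`. The excess over `ℓ(R/J^(n+1))` is `C(n+1+d,d) - C(n+d,d)`, the
number of monomials of degree `n+1` in `d` variables; the subtracted term is kept on the left to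
stay in `ℕ∞`. -/
theorem length_quotient_ofList_pow_mul_maximalIdeal (d : ℕ) : ∀ {R : Type u} [CommRing R]
    [IsLocalRing R] [IsNoetherianRing R] {rs : List R}, rs.length = d → IsWeaklyRegular R rs →
    (∀ r ∈ rs, r ∈ maximalIdeal R) → ∀ n : ℕ,
    Module.length R (R ⧸ Ideal.ofList rs ^ (n + 1) * maximalIdeal R) + (n + d).choose d =
      (n + 1 + d).choose d + (n + d).choose d * Module.length R (R ⧸ Ideal.ofList rs) := by
  induction d with
  | zero =>
    intro R _ _ _ rs hk _ _ n
    obtain rfl := List.length_eq_zero_iff.mp hk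
    have h : (Ideal.ofList ([] : List R)) ^ (n + 1) * maximalIdeal R = Ideal.ofList [] := by
      rw [Ideal.ofList_nil, ← Ideal.zero_eq_bot, zero_pow (Nat.succ_ne_zero n), zero_mul]
    rw [h]
    simp [add_comm]
  | succ d ih =>
    intro R _ _ _ rs hk hrs hm n
    obtain ⟨x, rs, rfl⟩ := List.exists_cons_of_length_eq_add_one hk
    have hk' : rs.length = d := by simpa using hk
    have hK : Ideal.ofList (x :: rs) ≤ maximalIdeal R := Ideal.span_le.mpr hm
    have := isLocalRing_quotient_span_singleton (hm x List.mem_cons_self)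
    obtain ⟨-, hrs'⟩ := (isWeaklyRegular_cons_iff_quotient x rs).mp hrs
    have key := ih (R := R ⧸ Ideal.span {x}) (rs := rs.map (Ideal.Quotient.mk (Ideal.span {x})))
      (by simpa using hk') hrs'
      (mk_mem_maximalIdeal fun r hr => hm r (List.mem_cons_of_mem _ hr))
    rw [length_quotient_map_ofList] at key
    have h := length_quotient_ofList_pow_mul hrs hm hK
    rw [map_mk_maximalIdeal] at h
    induction n with
    | zero =>
      rw [h, pow_zero, one_mul, length_quotient_maximalIdeal]
      have := key 0
      simp only [zero_add, Nat.choose_self, Nat.cast_one, one_mul] at this ⊢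
      rw [add_assoc, this, ← add_assoc]
      congr 1
      rw [add_comm 1 d, add_comm 1 (d + 1), Nat.choose_succ_self_right,
        Nat.choose_succ_self_right]
      push_cast
      ring
    | succ n ihn =>
      rw [h]
      have e1 : (n + 1 + (d + 1)).choose (d + 1) = (n + (d + 1)).choose (d + 1) +
          (n + 1 + d).choose d := by
        rw [show n + 1 + (d + 1) = (n + 1 + d) + 1 by ring, Nat.choose_succ_succ, add_comm,
          show n + (d + 1) = n + 1 + d by ring]
      have e2 : (n + 1 + 1 + (d + 1)).choose (d + 1) = (n + 1 + (d + 1)).choose (d + 1) +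
          (n + 1 + 1 + d).choose d := by
        rw [show n + 1 + 1 + (d + 1) = (n + 1 + 1 + d) + 1 by ring, Nat.choose_succ_succ, add_comm,
          show n + 1 + (d + 1) = n + 1 + 1 + d by ring]
      rw [e2]
      calc _ = _ := by rw [e1, Nat.cast_add, add_add_add_comm]
        _ = _ := by rw [ihn, key (n + 1)]
        _ = _ := by
          conv_rhs => rw [e1]
          conv_lhs => rw [e1]
          push_cast
          ring

end RegularSequenceLengths

/-! ### The Rees algebra -/

section Rees

universe u

variable {R : Type u} [CommRing R]

/-- The ideal of the Rees algebra with associated quotient the associated graded ring. -/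
def reesGradedIdeal (I : Ideal R) : Ideal (reesAlgebra I) where
  carrier := {p | ∀ i, (p : Polynomial R).coeff i ∈ I ^ (i + 1)}
  add_mem' := fun {p q} hp hq i => by
    simpa using add_mem (hp i) (hq i)
  zero_mem' := fun i => by simp
  smul_mem' := fun p q hq i => by
    simp only [smul_eq_mul, MulMemClass.coe_mul, Polynomial.coeff_mul]
    refine sum_mem fun jk hjk => ?_
    rw [← Finset.HasAntidiagonal.mem_antidiagonal.mp hjk, add_assoc, pow_add]
    exact Ideal.mul_mem_mul (p.2 jk.1) (hq jk.2)

/-- The degree-one part of the Rees algebra. -/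
noncomputable def reesDegreeOne (I : Ideal R) : I →ₗ[R] reesAlgebra I where
  toFun a := ⟨Polynomial.monomial 1 (a : R), reesAlgebra.monomial_mem.mpr (by simp)⟩
  map_add' a b := by ext1; simp
  map_smul' a b := by ext1; simp [Polynomial.smul_monomial]

theorem exists_mem_span_pow_eq_monomial (I : Ideal R) (n : ℕ) {a : R} (ha : a ∈ I ^ n) :
    ∃ p ∈ Ideal.span (Set.range (reesDegreeOne I)) ^ n,
      (p : Polynomial R) = Polynomial.monomial n a := by
  induction n generalizing a with
  | zero => exact ⟨algebraMap R _ a, by simp, by simp [Polynomial.monomial_zero_left]⟩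
  | succ n ih =>
    rw [pow_succ] at ha
    refine Submodule.mul_induction_on ha (fun b hb c hc => ?_) (fun b c hb hc => ?_)
    · obtain ⟨p, hp, hpb⟩ := ih hb
      refine ⟨p * reesDegreeOne I ⟨c, hc⟩, ?_, ?_⟩
      · rw [pow_succ]
        exact Ideal.mul_mem_mul hp (Ideal.subset_span ⟨_, rfl⟩)
      · simp [hpb, reesDegreeOne, Polynomial.monomial_mul_monomial]
    · obtain ⟨p, hp, hpb⟩ := hb
      obtain ⟨q, hq, hqc⟩ := hc
      exact ⟨p + q, add_mem hp hq, by simp [hpb, hqc]⟩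

end Rees

/-! ### Existence of superficial elements -/

section Superficial

universe u v

variable {R : Type u} [CommRing R] [IsLocalRing R]

/-- A finitely generated module over a local ring with infinite residue field is not a finite union
of proper submodules. -/
theorem exists_notMem_of_ne_top [Infinite (ResidueField R)] {M : Type v} [AddCommGroup M]
    [Module R M] [Module.Finite R M] (s : Finset (Submodule R M)) (hs : ∀ p ∈ s, p ≠ ⊤) :
    ∃ x : M, ∀ p ∈ s, x ∉ p := by
  by_contra! hcon
  have hcov : ⋃ p ∈ s, ((id p : Submodule R M) : Set M) = Set.univ := by
    refine Set.eq_univ_of_forall fun x => ?_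
    obtain ⟨p, hp, hx⟩ := hcon x
    exact Set.mem_biUnion hp hx
  -- B. H. Neumann's lemma: in a finite cover by subgroups one has finite index. A simple quotient
  -- of `M` would then be finite, yet it is a copy of the residue field.
  obtain ⟨p, hp, hfi⟩ := Submodule.exists_finiteIndex_of_cover hcov
  obtain ⟨q, hq, hpq⟩ := (eq_top_or_exists_le_coatom p).resolve_left (hs p hp)
  have : p.toAddSubgroup.FiniteIndex := hfi
  have : Finite (M ⧸ p) := AddSubgroup.finite_quotient_of_finiteIndex
  have : Finite (M ⧸ q) := Finite.of_surjective _ (Submodule.factor_surjective hpq)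
  have := (isSimpleModule_iff_isCoatom (m := q)).mpr hq
  obtain ⟨I, hI, ⟨e⟩⟩ := isSimpleModule_iff_quot_maximal.mp this
  obtain rfl := eq_maximalIdeal hI
  have : Infinite (R ⧸ maximalIdeal R) := inferInstanceAs (Infinite (ResidueField R))
  have : Infinite (M ⧸ q) := Infinite.of_injective _ e.symm.injective
  exact not_finite (M ⧸ q)

variable [IsNoetherianRing R] [Infinite (ResidueField R)]

/-- Take a primary decomposition of the ideal defining the associated graded ring, and let `x` avoid
the radical of every component whose radical misses part of degree one. These components allow
cancellation of `x` in degree one; every other component contains a power of the ideal generated by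
degree one, hence imposes nothing in high degree. -/
theorem exists_superficial (s : Set (Ideal R)) (hfin : s.Finite)
    (hs : ∀ p ∈ s, ¬ maximalIdeal R ≤ p) :
    ∃ x ∈ maximalIdeal R, (∀ p ∈ s, x ∉ p) ∧ ∃ c, ∀ n ≥ c, ∀ a ∈ maximalIdeal R ^ n,
      x * a ∈ maximalIdeal R ^ (n + 2) → a ∈ maximalIdeal R ^ (n + 1) := by
  classical
  set m := maximalIdeal R with hm
  let f := reesDegreeOne m
  obtain ⟨t, ht, hprim⟩ := Submodule.isLasker (reesAlgebra m) (reesAlgebra m) (reesGradedIdeal m)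
  let S1 : Finset (Submodule R m) := (t.image fun Q : Ideal (reesAlgebra m) =>
    (Submodule.restrictScalars R Q.radical).comap f).filter (· ≠ ⊤)
  let S2 : Finset (Submodule R m) := hfin.toFinset.image fun p : Ideal R =>
    Submodule.comap m.subtype p
  obtain ⟨x, hx⟩ := exists_notMem_of_ne_top (S1 ∪ S2) (by
    intro p hp
    rcases Finset.mem_union.mp hp with hp | hp
    · exact (Finset.mem_filter.mp hp).2
    · obtain ⟨q, hq, rfl⟩ := Finset.mem_image.mp hp
      intro h
      apply hs q (hfin.mem_toFinset.mp hq)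
      intro y hy
      have : (⟨y, hy⟩ : m) ∈ Submodule.comap m.subtype q := h ▸ Submodule.mem_top
      exact this)
  refine ⟨x, x.2, fun p hp hxp => ?_, ?_⟩
  · exact hx _ (Finset.mem_union_right _ (Finset.mem_image_of_mem _ (hfin.mem_toFinset.mpr hp))) hxp
  have hgood : ∀ Q ∈ t, f x ∈ Ideal.radical Q → ∃ c, Ideal.span (Set.range f) ^ c ≤ Q := by
    intro Q hQ hxQ
    have htop : (Submodule.restrictScalars R (Ideal.radical Q)).comap f = ⊤ := by
      by_contra hne
      refine hx _ (Finset.mem_union_left _ (Finset.mem_filter.mpr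
        ⟨Finset.mem_image_of_mem _ hQ, hne⟩)) hxQ
    have hle : Ideal.span (Set.range f) ≤ Ideal.radical Q := by
      rw [Ideal.span_le]
      rintro _ ⟨y, rfl⟩
      have : y ∈ (Submodule.restrictScalars R (Ideal.radical Q)).comap f := htop ▸ Submodule.mem_top
      exact this
    obtain ⟨c, hc⟩ := Ideal.exists_radical_pow_le_of_fg Q (IsNoetherian.noetherian _)
    exact ⟨c, (Ideal.pow_right_mono hle c).trans hc⟩
  choose! c hc using hgood
  refine ⟨t.sup c, fun n hn a ha hxa => ?_⟩
  obtain ⟨p, hp, hpa⟩ := exists_mem_span_pow_eq_monomial m n ha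
  have h1 : p * f x ∈ reesGradedIdeal m := by
    intro i
    have : ((p * f x : reesAlgebra m) : Polynomial R) = Polynomial.monomial (n + 1) (x * a) := by
      simp [hpa, f, reesDegreeOne, Polynomial.monomial_mul_monomial, mul_comm]
    rw [this, Polynomial.coeff_monomial]
    split_ifs with h
    · rw [← h]; exact hxa
    · exact zero_mem _
  have h2 : p ∈ reesGradedIdeal m := by
    rw [← ht, Submodule.mem_finsetInf] at h1 ⊢
    intro Q hQ
    rcases (Ideal.isPrimary_iff.mp (hprim hQ)).2 (h1 Q hQ) with h | h
    · exact h
    · exact hc Q hQ h (Ideal.pow_le_pow_right ((Finset.le_sup hQ).trans hn) hp)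
  have := h2 n
  rwa [hpa, Polynomial.coeff_monomial, if_pos rfl] at this

theorem exists_superficial_of_isWeaklyRegular {y : R} {ys : List R}
    (h : IsWeaklyRegular R (y :: ys)) (hm : ∀ r ∈ y :: ys, r ∈ maximalIdeal R) :
    ∃ x ∈ maximalIdeal R, IsWeaklyRegular R (x :: ys) ∧
      ∃ N, ∀ n ≥ N, ∀ a, x * a ∈ maximalIdeal R ^ (n + 1) → a ∈ maximalIdeal R ^ n := by
  obtain ⟨hys, hy⟩ := isSMulRegular_head_quotient_tail h hm
  have hzd := biUnion_associatedPrimes_eq_zero_divisors R (R ⧸ Ideal.ofList ys)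
  obtain ⟨x, hxm, hxp, c, hc⟩ := exists_superficial
    (associatedPrimes R (R ⧸ Ideal.ofList ys)) (associatedPrimes.finite _ _) (by
      intro p hp hle
      have hyp : y ∈ ⋃ p ∈ associatedPrimes R (R ⧸ Ideal.ofList ys), (p : Set R) :=
        Set.mem_biUnion hp (hle (hm y List.mem_cons_self))
      rw [hzd] at hyp
      obtain ⟨a, ha, hya⟩ := hyp
      exact ha ((isSMulRegular_iff_right_eq_zero_of_smul.mp hy) a hya))
  have hx : IsSMulRegular (R ⧸ Ideal.ofList ys) x := by
    rw [isSMulRegular_iff_right_eq_zero_of_smul]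
    intro a hxa
    by_contra ha
    have hmem : x ∈ ⋃ p ∈ associatedPrimes R (R ⧸ Ideal.ofList ys), (p : Set R) :=
      hzd ▸ ⟨a, ha, hxa⟩
    obtain ⟨p, hp, hxp'⟩ := Set.mem_iUnion₂.mp hmem
    exact hxp p hp hxp'
  have hreg : IsWeaklyRegular R (x :: ys) := by
    refine isWeaklyRegular_of_perm_of_subset_maximalIdeal
      ((isWeaklyRegular_concat_iff ys x).mpr ⟨hys, hx⟩) (List.perm_append_singleton x ys) ?_
    intro r hr
    rcases List.mem_append.mp hr with hr | hr
    · exact hm r (List.mem_cons_of_mem _ hr)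
    · rwa [List.mem_singleton.mp hr]
  refine ⟨x, hxm, hreg, ?_⟩
  have hx0 : IsSMulRegular R x := ((isWeaklyRegular_cons_iff_quotient x ys).mp hreg).1
  -- Artin–Rees and regularity of `x` put `a` in `𝔪^(n+1-k)`, hence in `𝔪^c`; superficiality then
  -- raises the exponent one at a time up to `n`.
  obtain ⟨k, hk⟩ := Ideal.exists_pow_inf_eq_pow_smul (M := R) (maximalIdeal R) (Ideal.span {x})
  refine ⟨k + c, fun n hn a ha => ?_⟩
  have hac : a ∈ maximalIdeal R ^ (n + 1 - k) := by
    have h1 : x * a ∈ maximalIdeal R ^ (n + 1 - k) * Ideal.span {x} := by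
      have h2 : x * a ∈ maximalIdeal R ^ (n + 1) • (⊤ : Submodule R R) ⊓ Ideal.span {x} :=
        ⟨by simpa using ha, Ideal.mul_mem_right _ _ (Ideal.mem_span_singleton_self x)⟩
      rw [hk (n + 1) (by omega)] at h2
      exact Submodule.smul_mono le_rfl inf_le_right h2
    obtain ⟨b, hb, hbx⟩ := Ideal.mem_mul_span_singleton.mp h1
    have : b = a := hx0 (by simpa [mul_comm] using hbx)
    rwa [← this]
  have climb : ∀ j, c + j ≤ n → a ∈ maximalIdeal R ^ (c + j) := by
    intro j
    induction j with
    | zero => intro _; exact Ideal.pow_le_pow_right (by omega) hac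
    | succ j ih =>
      intro hj
      exact hc (c + j) (by omega) a (ih (by omega)) (Ideal.pow_le_pow_right (by omega) ha)
  have := climb (n - c) (by omega)
  rwa [show c + (n - c) = n by omega] at this

end Superficial

/-! ### Reductions of the maximal ideal generated by a regular sequence -/

section Reduction

universe u

/-- In a Noetherian local ring with infinite residue field, a regular sequence can be replaced by a
regular sequence of the same length consisting of superficial elements. -/
theorem exists_superficial_sequence (d : ℕ) : ∀ {R : Type u} [CommRing R] [IsLocalRing R]
    [IsNoetherianRing R] [Infinite (ResidueField R)] {ys : List R}, ys.length = d →
    IsWeaklyRegular R ys → (∀ r ∈ ys, r ∈ maximalIdeal R) →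
    ∃ xs : List R, xs.length = d ∧ IsWeaklyRegular R xs ∧ (∀ r ∈ xs, r ∈ maximalIdeal R) ∧
      ∃ N, ∀ n ≥ N, maximalIdeal R ^ (n + 1) ⊓ Ideal.ofList xs ≤
        Ideal.ofList xs * maximalIdeal R ^ n := by
  induction d with
  | zero =>
    intro R _ _ _ _ ys hys _ _
    exact ⟨[], rfl, .nil _ _, by simp, 0, by simp⟩
  | succ d ih =>
    intro R _ _ _ _ ys hk hys hm
    obtain ⟨y, ys, rfl⟩ := List.exists_cons_of_length_eq_add_one hk
    obtain ⟨x, hxm, hreg, N, hN⟩ := exists_superficial_of_isWeaklyRegular hys hm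
    have := isLocalRing_quotient_span_singleton hxm
    have := IsLocalHom.of_surjective (Ideal.Quotient.mk (Ideal.span {x}))
      Ideal.Quotient.mk_surjective
    have : Infinite (ResidueField (R ⧸ Ideal.span {x})) :=
      Infinite.of_injective (ResidueField.map (Ideal.Quotient.mk (Ideal.span {x})))
        (RingHom.injective _)
    obtain ⟨hx0, hys'⟩ := (isWeaklyRegular_cons_iff_quotient x ys).mp hreg
    obtain ⟨zs, hzl, hzreg, hzm, N', hN'⟩ := ih (by simpa using hk) hys'
      (mk_mem_maximalIdeal fun r hr => hm r (List.mem_cons_of_mem _ hr))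
    obtain ⟨xs, rfl⟩ := List.map_surjective_iff.mpr
      (Ideal.Quotient.mk_surjective (I := Ideal.span {x})) zs
    refine ⟨x :: xs, by simpa using hzl, (isWeaklyRegular_cons_iff_quotient x xs).mpr ⟨hx0, hzreg⟩,
      ?_, max N N', ?_⟩
    · intro r hr
      rcases List.mem_cons.mp hr with rfl | hr
      · exact hxm
      · have := hzm _ (List.mem_map_of_mem hr)
        rw [mem_maximalIdeal, mem_nonunits_iff] at this ⊢
        exact fun h => this (h.map _)
    · rintro n hn a ⟨ha, haJ⟩
      have hle : Ideal.ofList xs ≤ Ideal.ofList (x :: xs) := by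
        rw [Ideal.ofList_cons]; exact le_sup_right
      have hxJ : x ∈ Ideal.ofList (x :: xs) := by
        rw [Ideal.ofList_cons]
        exact Ideal.mem_sup_left (Ideal.mem_span_singleton_self x)
      have h1 := hN' n (le_of_max_le_right hn) (x := Ideal.Quotient.mk _ a) ⟨by
        rw [← map_mk_maximalIdeal, ← Ideal.map_pow]
        exact Ideal.mem_map_of_mem _ ha, by
        rw [← map_mk_ofList_cons]
        exact Ideal.mem_map_of_mem _ haJ⟩
      rw [← Ideal.map_ofList, ← map_mk_maximalIdeal, ← Ideal.map_pow, ← Ideal.map_mul,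
        Ideal.mem_quotient_iff_mem_sup] at h1
      obtain ⟨b, hb, z, hz, rfl⟩ := Submodule.mem_sup.mp h1
      obtain ⟨e, rfl⟩ := Ideal.mem_span_singleton.mp hz
      have hb' := Ideal.mul_mono_left (K := maximalIdeal R ^ n) hle hb
      refine add_mem hb' (Ideal.mul_mem_mul hxJ (hN n (le_of_max_le_left hn) e ?_))
      -- This puts `xe = a - b` in `𝔪^(n+1)`, so that superficiality of `x` yields `e ∈ 𝔪^n`.
      have hbm : b ∈ maximalIdeal R ^ (n + 1) := by
        rw [pow_succ']
        refine Ideal.mul_mono_left ?_ hb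
        refine Ideal.span_le.mpr fun r hr => ?_
        have := hzm _ (List.mem_map_of_mem (f := Ideal.Quotient.mk (Ideal.span {x})) hr)
        rw [SetLike.mem_coe, mem_maximalIdeal, mem_nonunits_iff] at *
        exact fun h => this (h.map _)
      simpa using sub_mem ha hbm

theorem exists_maximalIdeal_pow_le_ofList {R : Type u} [CommRing R] [IsLocalRing R]
    [IsNoetherianRing R] {rs : List R}
    (h : IsWeaklyRegular R rs) (hm : ∀ r ∈ rs, r ∈ maximalIdeal R)
    (hd : ringKrullDim R = (rs.length : WithBot ℕ∞)) :
    ∃ k, maximalIdeal R ^ k ≤ Ideal.ofList rs := by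
  have hdim := ringKrullDim_add_length_eq_ringKrullDim_of_isRegular rs
    (.of_isWeaklyRegular_of_mem_maximalIdeal R hm h)
  have hne : Ideal.ofList rs ≠ ⊤ := fun h => (maximalIdeal.isMaximal R).ne_top
    (top_le_iff.mp (h ▸ Ideal.span_le.mpr hm))
  have : Nontrivial (R ⧸ Ideal.ofList rs) := Ideal.Quotient.nontrivial_iff.mpr hne
  have h0 : ringKrullDim (R ⧸ Ideal.ofList rs) = 0 := by
    refine (ENat.WithBot.add_natCast_cancel (c := rs.length)).mp ?_
    rw [hdim, hd, zero_add]
  have : IsArtinianRing (R ⧸ Ideal.ofList rs) :=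
    isArtinianRing_iff_krullDimLE_zero.mpr (ringKrullDimZero_iff_ringKrullDim_eq_zero.mpr h0)
  exact exists_maximalIdeal_pow_le_of_isArtinianRing_quotient (Ideal.ofList rs)

/-- The sequence has full length, so its ideal `J` contains a power of `𝔪`. For large `n` this gives
`𝔪^(n+1) = 𝔪^(n+1) ∩ J ⊆ J𝔪^n`, which is iterated. -/
theorem exists_reduction {R : Type u} [CommRing R] [IsLocalRing R]
    [IsNoetherianRing R] [Infinite (ResidueField R)] {ys : List R} (hys : IsWeaklyRegular R ys)
    (hm : ∀ r ∈ ys, r ∈ maximalIdeal R) (hd : ringKrullDim R = (ys.length : WithBot ℕ∞)) :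
    ∃ xs : List R, xs.length = ys.length ∧ IsWeaklyRegular R xs ∧
      (∀ r ∈ xs, r ∈ maximalIdeal R) ∧
      ∃ N, ∀ n, maximalIdeal R ^ (N + n) ≤ Ideal.ofList xs ^ n := by
  obtain ⟨xs, hl, hreg, hxm, N, hN⟩ := exists_superficial_sequence _ rfl hys hm
  refine ⟨xs, hl, hreg, hxm, ?_⟩
  obtain ⟨k, hk⟩ := exists_maximalIdeal_pow_le_ofList hreg hxm (by rw [hd, hl])
  refine ⟨max N k, fun n => ?_⟩
  have hstep : ∀ n ≥ max N k, maximalIdeal R ^ (n + 1) ≤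
      Ideal.ofList xs * maximalIdeal R ^ n := fun n hn => by
    refine le_trans (le_inf le_rfl ?_) (hN n (le_of_max_le_left hn))
    exact (Ideal.pow_le_pow_right ((le_of_max_le_right hn).trans n.le_succ)).trans hk
  induction n with
  | zero => simp
  | succ n ih =>
    have h1 := hstep (max N k + n) (Nat.le_add_right _ _)
    have h2 : Ideal.ofList xs * maximalIdeal R ^ (max N k + n) ≤
        Ideal.ofList xs * Ideal.ofList xs ^ n := Ideal.mul_mono_right ih
    rw [← pow_succ'] at h2
    exact h1.trans h2

end Reduction

/-! ### Limits and estimates of binomial coefficients -/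

section Asymptotics

theorem tendsto_natCast_add_div_succ (c : ℕ) :
    Tendsto (fun k : ℕ => ((k + c : ℕ) : ℝ) / ((k + 1 : ℕ) : ℝ)) atTop (𝓝 1) := by
  have h : Tendsto (fun k : ℕ => 1 + ((c : ℝ) - 1) / ((k : ℝ) + 1)) atTop (𝓝 (1 + 0)) := by
    refine tendsto_const_nhds.add ?_
    exact tendsto_const_nhds.div_atTop (tendsto_natCast_atTop_atTop.atTop_add tendsto_const_nhds)
  rw [add_zero] at h
  refine h.congr fun k => ?_
  have : (k : ℝ) + 1 ≠ 0 := by positivity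
  push_cast
  field_simp
  ring

theorem tendsto_factorial_mul_choose_div (d : ℕ) :
    Tendsto (fun k : ℕ => (d.factorial : ℝ) * ((k + d).choose d : ℝ) / ((k + 1 : ℕ) : ℝ) ^ d)
      atTop (𝓝 1) := by
  have hasc : ∀ k : ℕ, (d.factorial : ℝ) * ((k + d).choose d : ℝ) =
      ((k + 1).ascFactorial d : ℝ) := fun k => by
    rw [Nat.ascFactorial_eq_factorial_mul_choose]; push_cast; rfl
  have h := (tendsto_natCast_add_div_succ d).pow d
  rw [one_pow] at h
  refine tendsto_of_tendsto_of_tendsto_of_le_of_le tendsto_const_nhds h (fun k => ?_) fun k => ?_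
  · have hk : (0 : ℝ) < ((k + 1 : ℕ) : ℝ) ^ d := by positivity
    simp only
    rw [hasc, le_div_iff₀ hk, one_mul]
    exact_mod_cast Nat.pow_succ_le_ascFactorial (k + 1) d
  · simp only
    rw [hasc, div_pow]
    gcongr
    exact_mod_cast Nat.ascFactorial_le_pow_add k d

/-- Squeezing: a bounded shift of the argument does not affect the leading coefficient. It is
applied with `f k = ℓ(R/𝔪^k)` and `l = ℓ(R/J)`. -/
theorem eq_of_tendsto_of_le {d N l : ℕ} {e : ℝ} {f : ℕ → ℕ}
    (hf : Tendsto (fun k : ℕ => (d.factorial : ℝ) * (f k : ℝ) / (k : ℝ) ^ d) atTop (𝓝 e))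
    (h1 : ∀ k, f (k + 1) ≤ (k + d).choose d * l) (h2 : ∀ k, (k + d).choose d * l ≤ f (N + (k + 1))) :
    (l : ℝ) = e := by
  have hg := (tendsto_factorial_mul_choose_div d).mul_const (l : ℝ)
  rw [one_mul] at hg
  have hf1 := hf.comp (tendsto_add_atTop_nat 1)
  have hf2 := (hf.comp (tendsto_add_atTop_nat (N + 1))).mul
    ((tendsto_natCast_add_div_succ (N + 1)).pow d)
  rw [one_pow, mul_one] at hf2
  refine le_antisymm (le_of_tendsto_of_tendsto' hg hf2 fun k => ?_)
    (le_of_tendsto_of_tendsto' hf1 hg fun k => ?_)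
  · have hk : ((k + (N + 1) : ℕ) : ℝ) ^ d ≠ 0 := by positivity
    have hk' : (0 : ℝ) < ((k + 1 : ℕ) : ℝ) ^ d := by positivity
    simp only [Function.comp_apply]
    rw [div_pow, div_mul_div_comm, mul_comm (((k + (N + 1) : ℕ) : ℝ) ^ d),
      mul_div_mul_right _ _ hk, div_mul_eq_mul_div, mul_assoc]
    gcongr
    have := h2 k
    rw [show N + (k + 1) = k + (N + 1) by ring] at this
    exact_mod_cast this
  · simp only [Function.comp_apply]
    rw [div_mul_eq_mul_div, mul_assoc]
    gcongr
    exact_mod_cast h1 k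

/-- The surplus `(d+1)! - 1` over the evident bound `N^d` pays for the term `d! · d` in the final
inequality. -/
theorem pow_add_factorial_le_ascFactorial (N d : ℕ) (hN : 1 ≤ N) :
    N ^ d + (d + 1).factorial ≤ (N + 1).ascFactorial d + 1 := by
  induction d with
  | zero => simp
  | succ d ih =>
    have h1 : (N + 1).ascFactorial (d + 1) = (N + 1 + d) * (N + 1).ascFactorial d :=
      Nat.ascFactorial_succ
    have h2 : (d + 1 + 1).factorial = (d + 2) * (d + 1).factorial := Nat.factorial_succ _
    have h3 : 1 ≤ N ^ d := Nat.one_le_pow _ _ hN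
    have h4 : 1 ≤ (d + 1).factorial := Nat.factorial_pos _
    obtain ⟨a, ha⟩ := Nat.exists_eq_add_of_le h4
    obtain ⟨M, rfl⟩ := Nat.exists_eq_add_of_le hN
    rw [h1, h2, pow_succ]
    rw [ha] at ih ⊢
    have h5 := Nat.mul_le_mul_left (1 + M + 1 + d) (show (1 + M) ^ d + a ≤ (1 + M + 1).ascFactorial d by omega)
    have h6 : d * 1 ≤ d * (1 + M) ^ d := Nat.mul_le_mul_left _ h3
    nlinarith [Nat.zero_le (M * a)]

end Asymptotics

/-! ### The Hilbert function when the residue field is infinite -/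

section HilbertFunction

universe u

theorem length_quotient_maximalIdeal_pow_of_infinite {R : Type u} [CommRing R] [IsLocalRing R]
    [IsNoetherianRing R] [Infinite (ResidueField R)] {d : ℕ} {ys : List R}
    (hl : ys.length = d + 1) (hys : IsWeaklyRegular R ys)
    (hm : ∀ r ∈ ys, r ∈ maximalIdeal R) (hd : ringKrullDim R = ((d + 1 : ℕ) : WithBot ℕ∞)) {e : ℝ}
    (he : Tendsto (fun k : ℕ => ((d + 1).factorial : ℝ) *
      ((Module.length R (R ⧸ maximalIdeal R ^ k)).toNat : ℝ) / (k : ℝ) ^ (d + 1)) atTop (𝓝 e))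
    (h2 : ((Module.length R (R ⧸ maximalIdeal R ^ 2)).toNat : ℝ) = e + ((d + 1 : ℕ) : ℝ)) :
    ∃ l : ℕ, 1 ≤ l ∧ (l : ℝ) = e ∧ ∀ n,
      (Module.length R (R ⧸ maximalIdeal R ^ (n + 1))).toNat + (n + d).choose (d + 1) =
        (n + 1 + d).choose (d + 1) + (n + d).choose (d + 1) * l := by
  obtain ⟨xs, hxl, hreg, hxm, N, hN⟩ := exists_reduction hys hm (by rw [hd, hl])
  rw [hl] at hxl
  set J := Ideal.ofList xs with hJ
  have hJm : J ≤ maximalIdeal R := Ideal.span_le.mpr hxm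
  have hfm : ∀ k, Module.length R (R ⧸ maximalIdeal R ^ k) ≠ ⊤ := fun k =>
    length_quotient_ne_top le_rfl
  have hfJ : ∀ k, Module.length R (R ⧸ J ^ k) ≠ ⊤ := fun k => length_quotient_ne_top (hN k)
  obtain ⟨l, hlJ⟩ := ENat.ne_top_iff_exists.mp (hfJ 1)
  rw [pow_one] at hlJ
  have hpow := length_quotient_ofList_pow (d + 1) hxl hreg hxm
  have hpow' : ∀ k, (Module.length R (R ⧸ J ^ (k + 1))).toNat = (k + (d + 1)).choose (d + 1) * l :=
    fun k => by rw [hpow k, ← hJ, ← hlJ, ← Nat.cast_mul, ENat.toNat_natCast]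
  have hle : (l : ℝ) = e := eq_of_tendsto_of_le (N := N) he
    (fun k => by
      rw [← hpow' k]
      exact ENat.toNat_le_toNat (length_quotient_le (Ideal.pow_right_mono hJm _)) (hfJ _))
    (fun k => by
      rw [← hpow' k]
      exact ENat.toNat_le_toNat (length_quotient_le (hN _)) (hfm _))
  have hmul := length_quotient_ofList_pow_mul_maximalIdeal (d + 1) hxl hreg hxm
  rw [← hJ, ← hlJ] at hmul
  -- The only use of minimal multiplicity, in the form `h2`: both ideals have colength `l + d + 1`.
  have hmm : J * maximalIdeal R = maximalIdeal R ^ 2 := by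
    have hle' : J * maximalIdeal R ≤ maximalIdeal R ^ 2 := by
      rw [pow_two]; exact Ideal.mul_mono_left hJm
    have hft : Module.length R (R ⧸ J * maximalIdeal R) ≠ ⊤ := by
      refine length_quotient_ne_top (n := N + 2) ((hN 2).trans ?_)
      rw [pow_two]; exact Ideal.mul_mono_right hJm
    refine eq_of_length_quotient_eq hle' hft ?_
    obtain ⟨a, ha⟩ := ENat.ne_top_iff_exists.mp hft
    obtain ⟨b, hb⟩ := ENat.ne_top_iff_exists.mp (hfm 2)
    have h0 := hmul 0
    rw [zero_add, pow_one, ← ha] at h0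
    rw [← hb, ENat.toNat_natCast, ← hle] at h2
    rw [← ha, ← hb]
    simp only [zero_add, Nat.choose_self, Nat.cast_one, one_mul] at h0
    rw [add_comm 1 (d + 1), Nat.choose_succ_self_right] at h0
    norm_cast at h0 h2 ⊢
    omega
  have hmpow : ∀ n, J ^ (n + 1) * maximalIdeal R = maximalIdeal R ^ (n + 2) := by
    intro n
    induction n with
    | zero => rw [zero_add, pow_one, hmm]
    | succ n ih =>
      calc J ^ (n + 1 + 1) * maximalIdeal R = J * (J ^ (n + 1) * maximalIdeal R) := by ring
        _ = J * maximalIdeal R * maximalIdeal R ^ (n + 1) := by rw [ih]; ring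
        _ = maximalIdeal R ^ (n + 1 + 2) := by rw [hmm]; ring
  refine ⟨l, ?_, hle, fun n => ?_⟩
  · by_contra hl0
    have : l = 0 := by omega
    rw [this, Nat.cast_zero, eq_comm, Module.length_eq_zero_iff, Ideal.Quotient.subsingleton_iff]
      at hlJ
    exact (maximalIdeal.isMaximal R).ne_top (top_le_iff.mp (hlJ ▸ hJm))
  · rcases n with _ | n
    · have : Module.length R (R ⧸ maximalIdeal R ^ 1) = 1 := by
        rw [pow_one]; exact length_quotient_maximalIdeal
      rw [zero_add, this]
      simp [add_comm 1 d]
    · obtain ⟨a, ha⟩ := ENat.ne_top_iff_exists.mp (hfm (n + 1 + 1))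
      have h0 := hmul n
      rw [hmpow n, ← ha] at h0
      rw [← ha, ENat.toNat_natCast]
      norm_cast at h0
      rw [show n + 1 + d = n + (d + 1) by ring, show n + 1 + 1 + d = n + 1 + (d + 1) by ring]
      exact h0

end HilbertFunction

/-! ### Reduction to an infinite residue field -/

section BaseChange

universe u v

theorem exists_flat_extension_infinite_residueField (R : Type u) [CommRing R] [IsLocalRing R]
    [IsNoetherianRing R] :
    ∃ (S : Type u) (_ : CommRing S) (_ : IsLocalRing S) (_ : IsNoetherianRing S) (_ : Algebra R S),
      Module.Flat R S ∧ Infinite (ResidueField S) ∧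
      (maximalIdeal R).map (algebraMap R S) = maximalIdeal S := by
  have hP : ((maximalIdeal R).map (Polynomial.C : R →+* Polynomial R)).IsPrime :=
    Ideal.isPrime_map_C_of_isPrime
  set P := (maximalIdeal R).map (Polynomial.C : R →+* Polynomial R) with hPdef
  have : Module.Flat (Polynomial R) (Localization.AtPrime P) :=
    IsLocalization.flat _ P.primeCompl
  refine ⟨Localization.AtPrime P, inferInstance, inferInstance,
    IsLocalization.isNoetherianRing P.primeCompl _ inferInstance, inferInstance,
    Module.Flat.trans R (Polynomial R) _, ?_, ?_⟩
  · have h1 : Infinite (Polynomial R ⧸ P) := Infinite.of_injective _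
      (Ideal.polynomialQuotientEquivQuotientPolynomial (maximalIdeal R)).injective
    exact Infinite.of_injective _ (Ideal.injective_algebraMap_quotient_residueField P)
  · rw [IsScalarTower.algebraMap_eq R (Polynomial R) (Localization.AtPrime P), ← Ideal.map_map]
    exact Localization.AtPrime.map_eq_maximalIdeal

variable {R : Type u} [CommRing R] [IsLocalRing R] {S : Type v} [CommRing S] [IsLocalRing S]
  [Algebra R S]

theorem isLocalHom_of_map_maximalIdeal_eq
    (h : (maximalIdeal R).map (algebraMap R S) = maximalIdeal S) :
    IsLocalHom (algebraMap R S) :=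
  ((IsLocalRing.local_hom_TFAE (algebraMap R S)).out 0 2).mpr h.le

/-- Under flat local base change lengths are multiplied by the length of the closed fibre `S/𝔪S`,
which is here a field. -/
theorem length_quotient_maximalIdeal_pow_eq [Module.Flat R S]
    (h : (maximalIdeal R).map (algebraMap R S) = maximalIdeal S) (k : ℕ) :
    Module.length S (S ⧸ maximalIdeal S ^ k) = Module.length R (R ⧸ maximalIdeal R ^ k) := by
  have := isLocalHom_of_map_maximalIdeal_eq h
  have h1 := IsLocalRing.length_baseChange R S (R ⧸ maximalIdeal R ^ k)
  rw [h, length_quotient_maximalIdeal, mul_one] at h1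
  rw [← h1, ← h, ← Ideal.map_pow]
  exact (Algebra.TensorProduct.quotIdealMapEquivTensorQuot S
    (maximalIdeal R ^ k)).toLinearEquiv.length_eq

/-- Applied to the extension `S`, this reads its dimension off the image of the regular sequence of
`R`. -/
theorem ringKrullDim_eq_of_maximalIdeal_pow_le [IsNoetherianRing R] {rs : List R}
    (h : IsWeaklyRegular R rs) (hm : ∀ r ∈ rs, r ∈ maximalIdeal R) {k : ℕ}
    (hk : maximalIdeal R ^ k ≤ Ideal.ofList rs) :
    ringKrullDim R = (rs.length : WithBot ℕ∞) := by
  rw [← ringKrullDim_add_length_eq_ringKrullDim_of_isRegular rs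
    (.of_isWeaklyRegular_of_mem_maximalIdeal R hm h)]
  have hne : Ideal.ofList rs ≠ ⊤ := fun h => (maximalIdeal.isMaximal R).ne_top
    (top_le_iff.mp (h ▸ Ideal.span_le.mpr hm))
  have : Nontrivial (R ⧸ Ideal.ofList rs) := Ideal.Quotient.nontrivial_iff.mpr hne
  have := isArtinianRing_quotient hk
  rw [ringKrullDimZero_iff_ringKrullDim_eq_zero.mp (isArtinianRing_iff_krullDimLE_zero.mp this),
    zero_add]

theorem length_quotient_maximalIdeal_pow [IsNoetherianRing R] {d : ℕ} {ys : List R}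
    (hl : ys.length = d + 1) (hys : IsWeaklyRegular R ys)
    (hm : ∀ r ∈ ys, r ∈ maximalIdeal R) (hd : ringKrullDim R = ((d + 1 : ℕ) : WithBot ℕ∞)) {e : ℝ}
    (he : Tendsto (fun k : ℕ => ((d + 1).factorial : ℝ) *
      ((Module.length R (R ⧸ maximalIdeal R ^ k)).toNat : ℝ) / (k : ℝ) ^ (d + 1)) atTop (𝓝 e))
    (h2 : ((Module.length R (R ⧸ maximalIdeal R ^ 2)).toNat : ℝ) = e + ((d + 1 : ℕ) : ℝ)) :
    ∃ l : ℕ, 1 ≤ l ∧ (l : ℝ) = e ∧ ∀ n,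
      (Module.length R (R ⧸ maximalIdeal R ^ (n + 1))).toNat + (n + d).choose (d + 1) =
        (n + 1 + d).choose (d + 1) + (n + d).choose (d + 1) * l := by
  obtain ⟨S, _, _, _, _, hflat, hinf, hS⟩ := exists_flat_extension_infinite_residueField R
  have hlen := length_quotient_maximalIdeal_pow_eq hS
  have hysS : IsWeaklyRegular S (ys.map (algebraMap R S)) := hys.of_flat
  have hmS : ∀ r ∈ ys.map (algebraMap R S), r ∈ maximalIdeal S := by
    intro r hr
    obtain ⟨s, hs, rfl⟩ := List.mem_map.mp hr
    rw [← hS]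
    exact Ideal.mem_map_of_mem _ (hm s hs)
  obtain ⟨k, hk⟩ := exists_maximalIdeal_pow_le_ofList hys hm (by rw [hd, hl])
  have hkS : maximalIdeal S ^ k ≤ Ideal.ofList (ys.map (algebraMap R S)) := by
    rw [← hS, ← Ideal.map_pow, ← Ideal.map_ofList]
    exact Ideal.map_mono hk
  have hlS : (ys.map (algebraMap R S)).length = d + 1 := by simpa using hl
  have hdS := ringKrullDim_eq_of_maximalIdeal_pow_le hysS hmS hkS
  rw [hlS] at hdS
  simp only [← hlen] at he h2 ⊢
  exact length_quotient_maximalIdeal_pow_of_infinite hlS hysS hmS hdS he h2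

end BaseChange

/-! ### Multiplicity of powers -/

section Multiplicity

theorem HasMultiplicity.pow {R : Type*} [CommRing R] {I : Ideal R} {e : ℝ} (h : HasMultiplicity I e) {n : ℕ} (hn : 1 ≤ n) :
    HasMultiplicity (I ^ n) ((n : ℝ) ^ dim R * e) := by
  -- Since `(I^n)^k = I^(nk)`, the subsequence of multiples of `n` is used.
  have h1 := (h.comp (tendsto_id.const_mul_atTop' hn)).const_mul ((n : ℝ) ^ dim R)
  refine h1.congr fun k => ?_
  have hn0 : (n : ℝ) ^ dim R ≠ 0 := by positivity
  simp only [Function.comp_apply, id]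
  rw [← pow_mul, Nat.cast_mul, mul_pow, mul_div_assoc', mul_div_mul_left _ _ hn0]

end Multiplicity

/-! ### Numbers of generators as differences of lengths -/

section Generators

universe u

variable {R : Type u} [CommRing R] [IsLocalRing R] [IsNoetherianRing R]

/-- Additivity along `0 → I/𝔪I → R/𝔪I → R/I → 0`; by Nakayama, `μ(I)` is the dimension of `I/𝔪I`
over the residue field. -/
theorem length_quotient_maximalIdeal_mul (I : Ideal R) :
    Module.length R (R ⧸ maximalIdeal R * I) =
      numGenerators I + Module.length R (R ⧸ I) := by
  have hle : maximalIdeal R • (⊤ : Submodule R I) ≤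
      Submodule.comap I.subtype (maximalIdeal R * I) := by
    rw [← Submodule.map_le_iff_le_comap, Submodule.map_smul'', Submodule.map_top,
      Submodule.range_subtype, smul_eq_mul]
  have hgen : Module.length R (I ⧸ maximalIdeal R • (⊤ : Submodule R I)) = numGenerators I := by
    let : Field (R ⧸ maximalIdeal R) := Ideal.Quotient.field _
    let : Module (R ⧸ maximalIdeal R) (I ⧸ maximalIdeal R • (⊤ : Submodule R I)) := inferInstance
    have : IsScalarTower R (R ⧸ maximalIdeal R) (I ⧸ maximalIdeal R • (⊤ : Submodule R I)) :=
      inferInstance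
    have : Module.Finite (R ⧸ maximalIdeal R) (I ⧸ maximalIdeal R • (⊤ : Submodule R I)) :=
      Module.Finite.of_restrictScalars_finite R _ _
    rw [Module.length_eq_of_surjective (R := R ⧸ maximalIdeal R) Ideal.Quotient.mk_surjective,
      Module.length_eq_finrank, numGenerators,
      spanFinrank_eq_finrank_quotient I (IsNoetherian.noetherian I)]
  rw [← hgen]
  refine Module.length_eq_add_of_exact (Submodule.mapQ _ _ I.subtype hle)
    (Submodule.factor (Ideal.mul_le_right : maximalIdeal R * I ≤ I)) ?_ ?_ ?_
  · rw [injective_iff_map_eq_zero]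
    intro a
    obtain ⟨a, rfl⟩ := Submodule.mkQ_surjective _ a
    intro ha
    have ha' : (a : R) ∈ maximalIdeal R * I := (Submodule.Quotient.mk_eq_zero _).mp ha
    refine (Submodule.Quotient.mk_eq_zero _).mpr ?_
    have : (a : R) ∈ Submodule.map I.subtype (maximalIdeal R • (⊤ : Submodule R I)) := by
      rwa [Submodule.map_smul'', Submodule.map_top, Submodule.range_subtype, smul_eq_mul]
    obtain ⟨b, hb, hba⟩ := this
    rwa [← Subtype.ext hba]
  · exact Submodule.factor_surjective _
  · intro a
    obtain ⟨a, rfl⟩ := Submodule.mkQ_surjective _ a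
    constructor
    · intro ha
      have ha' : a ∈ I := (Submodule.Quotient.mk_eq_zero _).mp ha
      exact ⟨Submodule.Quotient.mk ⟨a, ha'⟩, rfl⟩
    · rintro ⟨b, hb⟩
      obtain ⟨b, rfl⟩ := Submodule.mkQ_surjective _ b
      rw [← hb]
      exact (Submodule.Quotient.mk_eq_zero _).mpr b.2

theorem numGenerators_maximalIdeal_pow_add (n : ℕ) :
    numGenerators (maximalIdeal R ^ n) + (Module.length R (R ⧸ maximalIdeal R ^ n)).toNat =
      (Module.length R (R ⧸ maximalIdeal R ^ (n + 1))).toNat := by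
  have h := length_quotient_maximalIdeal_mul (maximalIdeal R ^ n)
  rw [← pow_succ'] at h
  rw [h, ENat.toNat_add (ENat.natCast_ne_top _) (length_quotient_ne_top le_rfl),
    ENat.toNat_natCast]

end Generators

/-! ### The inequality for powers of the maximal ideal -/

section MinimalMultiplicity

theorem satisfiesInequalityA_maximalIdeal_pow (R : Type*) [CommRing R] [IsLocalRing R] [IsNoetherianRing R]
    (d : ℕ) (hd : ringKrullDim R = (d : WithBot ℕ∞)) (hd1 : 1 ≤ d)
    (hCM : IsCohenMacaulay R)
    (hmin : HasMinimalMultiplicity R) (n : ℕ) (hn : 1 ≤ n) :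
    SatisfiesInequalityA (maximalIdeal R ^ n) := by
  -- From here on the dimension is `d + 1` and the exponent is `n + 1`.
  obtain ⟨d, rfl⟩ := Nat.exists_eq_add_of_le' hd1
  obtain ⟨n, rfl⟩ := Nat.exists_eq_add_of_le' hn
  have hdim : dim R = d + 1 := by
    rw [dim, hd]; rfl
  obtain ⟨ys, hm, hys, hlen⟩ := hCM
  have hl : ys.length = d + 1 := by
    rw [hd] at hlen
    exact_mod_cast hlen
  have hmin' := hmin
  rw [HasMinimalMultiplicity, HasMultiplicity, hdim] at hmin'
  have h2 := numGenerators_maximalIdeal_pow_add (R := R) 1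
  have h1 : (Module.length R (R ⧸ maximalIdeal R ^ 1)).toNat = 1 := by
    rw [pow_one, length_quotient_maximalIdeal]; rfl
  rw [h1, pow_one] at h2
  obtain ⟨l, hl1, hle, hL⟩ := length_quotient_maximalIdeal_pow hl hys.toIsWeaklyRegular hm hd hmin'
    (by rw [← h2]; push_cast; ring)
  -- the number of generators of `𝔪 ^ (j + 1)`
  have hμ : ∀ j, numGenerators (maximalIdeal R ^ (j + 1)) + (j + d).choose d =
      (j + 1 + d).choose d + (j + d).choose d * l := by
    intro j
    have e1 := numGenerators_maximalIdeal_pow_add (R := R) (j + 1)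
    have e2 := hL j
    have e3 := hL (j + 1)
    have e4 : (j + 1 + d).choose (d + 1) = (j + d).choose d + (j + d).choose (d + 1) := by
      rw [show j + 1 + d = j + d + 1 by ring, Nat.choose_succ_succ]
    have e5 : (j + 1 + 1 + d).choose (d + 1) =
        (j + 1 + d).choose d + (j + 1 + d).choose (d + 1) := by
      rw [show j + 1 + 1 + d = j + 1 + d + 1 by ring, Nat.choose_succ_succ]
    rw [e5, e4, add_mul] at e3
    rw [e4] at e2
    omega
  have hloewy : n + 1 ≤ loewyLength (maximalIdeal R ^ (n + 1)) := by
    refine le_csInf ⟨n + 1, le_refl (maximalIdeal R ^ (n + 1))⟩ fun k hk => ?_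
    -- A smaller `k` would give `𝔪^k = 𝔪^(k+1)`, hence `μ(𝔪^(k+1)) = 0`, against `hμ`.
    by_contra! hlt
    have h3 : maximalIdeal R ^ k = maximalIdeal R ^ (k + 1) :=
      le_antisymm (le_trans hk (Ideal.pow_le_pow_right hlt)) (Ideal.pow_le_pow_right k.le_succ)
    have h4 := numGenerators_maximalIdeal_pow_add (R := R) (k + 1)
    have h5 : maximalIdeal R ^ (k + 1 + 1) = maximalIdeal R ^ (k + 1) := by
      rw [pow_succ, ← h3, ← pow_succ, ← h3]
    rw [h5] at h4
    have h6 := hμ k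
    have h7 : (k + d).choose d ≤ (k + d).choose d * l := Nat.le_mul_of_pos_right _ hl1
    have h8 : 0 < (k + 1 + d).choose d := Nat.choose_pos (Nat.le_add_left _ _)
    omega
  have hmult := HasMultiplicity.pow hmin hn
  refine ⟨_, hmult, ?_⟩
  rw [hdim, ← hle]
  have hA := pow_add_factorial_le_ascFactorial (n + 1) d hn
  have hB := Nat.pow_succ_le_ascFactorial (n + 1) d
  rw [Nat.ascFactorial_eq_factorial_mul_choose] at hA hB
  have hfac : (d + 1).factorial = d * d.factorial + d.factorial := by
    rw [Nat.factorial_succ]; ring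
  have hpos : 1 ≤ d.factorial := d.factorial_pos
  have hgen : (n + 1) ^ d * l + d.factorial * d ≤
      d.factorial * numGenerators (maximalIdeal R ^ (n + 1)) := by
    -- With `l = 1 + c`, the sharp bound `hA` is spent once, on `C(n+1+d,d)`, and the plain bound
    -- `hB` on the `c` copies of `C(n+d,d)`.
    obtain ⟨c, rfl⟩ := Nat.exists_eq_add_of_le hl1
    have h3 := congrArg (d.factorial * ·) (hμ n)
    simp only [mul_add, mul_one] at h3
    have h4 := Nat.mul_le_mul_right c hB
    rw [mul_assoc] at h4
    rw [hfac] at hA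
    rw [mul_add, mul_one, mul_comm d.factorial d]
    omega
  have hgen' : ((n + 1 : ℕ) : ℝ) ^ d * l ≤
      d.factorial * (numGenerators (maximalIdeal R ^ (n + 1)) - ((d + 1 : ℕ) : ℝ) + 1) := by
    have : (((n + 1) ^ d * l + d.factorial * d : ℕ) : ℝ) ≤
      ((d.factorial * numGenerators (maximalIdeal R ^ (n + 1)) : ℕ) : ℝ) := Nat.cast_le.mpr hgen
    push_cast at this ⊢
    linarith
  calc ((n + 1 : ℕ) : ℝ) ^ (d + 1) * l = ((n + 1 : ℕ) : ℝ) ^ d * l * ((n + 1 : ℕ) : ℝ) := by ring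
    _ ≤ _ := mul_le_mul hgen' (Nat.cast_le.mpr hloewy) (by positivity)
      (le_trans (by positivity) hgen')

end MinimalMultiplicity

end PowersInequality

theorem mainTheorem10 (R : Type*) [CommRing R] [IsLocalRing R] [IsNoetherianRing R]
    (d : ℕ) (hd : ringKrullDim R = (d : WithBot ℕ∞)) (hd1 : 1 ≤ d)
    (hCM : PowersInequality.IsCohenMacaulay R)
    (hmin : PowersInequality.HasMinimalMultiplicity R) (n : ℕ) (hn : 1 ≤ n) :
    PowersInequality.SatisfiesInequalityA (maximalIdeal R ^ n) :=
  PowersInequality.satisfiesInequalityA_maximalIdeal_pow R d hd hd1 hCM hmin n hn
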